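/- Let $U$ be a finite set, let $\mathcal M$ be a matroid on $U$, and let $\mathcal P_{\mathcal M}\subseteq[0,1]^U$ be its matroid polytope, i.e. the convex hull of the indicator vectors of the independent sets of $\mathcal M$. Let $\mathcal D$ be a probability distribution over $2^U$ with marginals $x_i=\Pr_{S\sim\mathcal D}[i\in S]$, $i\in U$. Suppose that $\mathcal D$ satisfies Weak Negative Regression (WNR): for every $i\in U$ with $0<x_i<1$ and every monotone function $f:2^U\to\mathbb R$ (that is, $f(S)\le f(T)$ whenever $S\subseteq T$), $$\mathbb E_{S\sim\mathcal D}\bigl[f(S\setminus\{i\})\mid i\in S\bigr]\;\le\;\mathbb E_{S\sim\mathcal D}\bigl[f(S\setminus\{i\})\mid i\notin S\bigr].$$ If $\mathbf x=(x_i)_{i\in U}\in\mathcal P_{\mathcal M}$, then there exists a $(1-1/e)$-selectable contention resolution scheme for $\mathcal M$ and $\mathcal D$: a (possibly randomized) mapping $\pi$ that sends every $S\subseteq U$ to an independent set $\pi(S)$ of $\mathcal M$ with $\pi(S)\subseteq S$, such that $$\Pr_{S\sim\mathcal D}\bigl[i\in\pi(S)\bigr]\;\ge\;\Bigl(1-\frac1e\Bigr)\,x_i\qquad\text{for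 all } i\in U,$$ where the probability is over both $S\sim\mathcal D$ and the randomness of $\pi$. -/

import Mathlib

/-- The probability that a random set `S ∼ D` satisfies `p`. -/
noncomputable def setProb {U : Type*} [Fintype U] [DecidableEq U]
    (D : PMF (Finset U)) (p : Finset U → Prop) [DecidablePred p] : ℝ :=
  ∑ S with p S, (D S).toReal

/-- The vector of marginals of `D`: the `i`-th entry is the probability that `i ∈ S` for `S ∼ D`. -/
noncomputable def marginals {U : Type*} [Fintype U] [DecidableEq U]
    (D : PMF (Finset U)) (i : U) : ℝ :=
  setProb D (fun S => i ∈ S)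

/-- The conditional expectation of `g S` for `S ∼ D` given the event `p S`
(meaningful only if that event has positive probability). -/
noncomputable def condExpectation {U : Type*} [Fintype U] [DecidableEq U]
    (D : PMF (Finset U)) (p : Finset U → Prop) [DecidablePred p] (g : Finset U → ℝ) : ℝ :=
  (∑ S with p S, (D S).toReal * g S) / setProb D p

/-- Weak Negative Regression: `E[f (S \ i) | i ∈ S] ≤ E[f (S \ i) | i ∉ S]` for every element `i`
and every monotone `f`. The inequality is required exactly for those `i` for which both
conditional expectations are defined, i.e. both events have positive probability. -/
def IsWNR {U : Type*} [Fintype U] [DecidableEq U] (D : PMF (Finset U)) : Prop :=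
  ∀ i : U, 0 < setProb D (fun S => i ∈ S) → 0 < setProb D (fun S => i ∉ S) →
    ∀ f : Finset U → ℝ, Monotone f →
      condExpectation D (fun S => i ∈ S) (fun S => f (S \ {i})) ≤
        condExpectation D (fun S => i ∉ S) (fun S => f (S \ {i}))

/-- The matroid polytope: the convex hull of the indicator vectors of the independent sets.
It contains the convex hull of the indicator vectors of the bases (maximal independent sets). -/
def matroidPolytope {U : Type*} (M : Matroid U) : Set (U → ℝ) :=
  convexHull ℝ {v | ∃ I : Set U, M.Indep I ∧ v = I.indicator 1}

/-- A contention resolution scheme: a randomized map (each `S` is sent to a distribution on sets)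
whose value at `S` is, with probability one, an independent subset of `S`. -/
def IsContentionResolutionScheme {U : Type*} (M : Matroid U)
    (π : Finset U → PMF (Finset U)) : Prop :=
  ∀ S, ∀ T ∈ (π S).support, T ⊆ S ∧ M.Indep (T : Set U)

/-- `π` is `c`-selectable for `D`: for `S ∼ D`, every `i` belongs to the random set `π S` with
probability at least `c` times its marginal. Here `D.bind π` is the law of `π S` for `S ∼ D`. -/
def IsSelectable {U : Type*} [Fintype U] [DecidableEq U] (c : ℝ) (D : PMF (Finset U))
    (π : Finset U → PMF (Finset U)) : Prop :=
  ∀ i : U, c * marginals D i ≤ setProb (D.bind π) (fun T => i ∈ T)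

/-! By separating the compact convex set of achievable selection vectors from an orthant, it
suffices to show for each weight `w ≥ 0` that the expected maximum weight of an independent subset
of `S` is at least `(1 - 1/e) ∑ x_i w_i` (`exists_le_selectionProb`). This maximum is bounded below
by a monotone submodular `f ≥ 0` that dominates `w` on independent sets (`exists_weightedRank`), so
the claim is a correlation gap for `f`.

Thin `S` by an independent Bernoulli(`t`) set `R` and put `φ(t) = E f(S ∩ R)`. By Russo's formula,
`φ'(t)` sums over `i` the expected gain of `i` at `(S \ {i}) ∩ R`, restricted to `i ∈ S`. For fixed
`R` this gain is antitone in `S \ {i}`, so WNR decouples it from the event `i ∈ S`, and `φ'(t) ≥ ∑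
x_i E[gain of i at S ∩ R]`. Since `x` lies in the polytope, this is at least `∑ x_i w_i - φ(t)`.
Integrating the differential inequality from `φ(0) ≥ 0` gives the factor `1 - 1/e` at `t = 1`, where
nothing is thinned. -/

/-- The probability that a random set containing each element independently with probability `t`
equals `R`. -/
noncomputable def bernoulliWeight {U : Type*} [Fintype U] [DecidableEq U]
    (t : ℝ) (R : Finset U) : ℝ :=
  ∏ i, if i ∈ R then t else 1 - t

/-! ### Bernoulli random sets and Russo's formula -/

section Bernoulli

variable {U : Type*} [Fintype U] [DecidableEq U]

theorem bernoulliWeight_nonneg {t : ℝ} (h0 : 0 ≤ t) (h1 : t ≤ 1) (R : Finset U) :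
    0 ≤ bernoulliWeight t R :=
  Finset.prod_nonneg fun i _ => by split_ifs <;> linarith

theorem sum_bernoulliWeight (t : ℝ) : ∑ R : Finset U, bernoulliWeight t R = 1 := by
  have h := Finset.prod_add (fun _ : U => t) (fun _ => 1 - t) Finset.univ
  simp only [add_sub_cancel, Finset.prod_const_one, Finset.powerset_univ] at h
  rw [h]
  refine Finset.sum_congr rfl fun R _ => ?_
  rw [bernoulliWeight, Finset.prod_ite]
  congr 2 <;> ext <;> simp

theorem bernoulliWeight_one (R : Finset U) :
    bernoulliWeight 1 R = if R = Finset.univ then 1 else 0 := by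
  split_ifs with h
  · simp [bernoulliWeight, h]
  · obtain ⟨i, hi⟩ : ∃ i, i ∉ R := by
      by_contra! hc
      exact h (Finset.eq_univ_iff_forall.2 hc)
    exact Finset.prod_eq_zero (Finset.mem_univ i) (by simp [hi])

theorem sum_finset_eq_sum_notMem_insert (i : U) (F : Finset U → ℝ) :
    ∑ R, F R = ∑ R with i ∉ R, (F R + F (insert i R)) := by
  rw [← Finset.sum_filter_add_sum_filter_not Finset.univ (fun R => i ∉ R) F,
    Finset.sum_add_distrib]
  congr 1
  refine Finset.sum_nbij' (fun R => R.erase i) (fun R => insert i R) ?_ ?_ ?_ ?_ ?_ <;>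
    simp +contextual [Finset.insert_erase]

/-- Russo's formula for the derivative of an expectation over a Bernoulli random set. -/
theorem hasDerivAt_sum_bernoulliWeight_mul (g : Finset U → ℝ) (t : ℝ) :
    HasDerivAt (fun t => ∑ R, bernoulliWeight t R * g R)
      (∑ i, ∑ R, bernoulliWeight t R * (g (insert i R) - g (R.erase i))) t := by
  set P : U → Finset U → ℝ := fun i R =>
    ∏ j ∈ Finset.univ.erase i, if j ∈ R then t else 1 - t with hP
  have hder : ∀ R : Finset U, HasDerivAt (fun t => bernoulliWeight t R)
      (∑ i, P i R * (if i ∈ R then 1 else -1)) t := by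
    intro R
    have h : ∀ i ∈ (Finset.univ : Finset U), HasDerivAt
        (fun t : ℝ => if i ∈ R then t else 1 - t) (if i ∈ R then 1 else -1) t := by
      intro i _
      split_ifs
      · exact hasDerivAt_id t
      · exact (hasDerivAt_id t).const_sub 1
    simpa [bernoulliWeight, hP] using HasDerivAt.fun_finsetProd h
  have hsum := HasDerivAt.fun_sum
    (fun (R : Finset U) (_ : R ∈ Finset.univ) => (hder R).mul_const (g R))
  refine hsum.congr_deriv ?_
  simp_rw [Finset.sum_mul]
  rw [Finset.sum_comm]
  refine Finset.sum_congr rfl fun i _ => ?_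
  -- Pair `R` with `insert i R`: both have the same difference of `g`, and their weights `(1 - t) P`
  -- and `t P` add up to `P`.
  rw [sum_finset_eq_sum_notMem_insert i, sum_finset_eq_sum_notMem_insert i]
  refine Finset.sum_congr rfl fun R hR => ?_
  have hR : i ∉ R := by simpa using hR
  have hPi : P i (insert i R) = P i R := by
    refine Finset.prod_congr rfl fun j hj => ?_
    simp [Finset.ne_of_mem_erase hj]
  have hw : ∀ Q : Finset U, bernoulliWeight t Q = (if i ∈ Q then t else 1 - t) * P i Q :=
    fun Q => (Finset.mul_prod_erase _ _ (Finset.mem_univ i)).symm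
  rw [hw, hw, hPi]
  simp only [hR, if_false, Finset.mem_insert_self, if_true, Finset.insert_idem,
    Finset.erase_insert hR, Finset.erase_eq_of_notMem hR]
  ring

end Bernoulli

/-! ### WNR as a correlation inequality -/

section WeakNegativeRegression

theorem sum_toReal_eq_one {U : Type*} [Fintype U] (D : PMF (Finset U)) : ∑ S, (D S).toReal = 1 := by
  rw [← ENNReal.toReal_sum fun S _ => D.apply_ne_top S, ← tsum_fintype (L := .unconditional _),
    D.tsum_coe, ENNReal.toReal_one]

variable {U : Type*} [Fintype U] [DecidableEq U]

theorem setProb_mem_add_setProb_notMem (D : PMF (Finset U)) (i : U) :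
    setProb D (fun S => i ∈ S) + setProb D (fun S => i ∉ S) = 1 := by
  rw [← sum_toReal_eq_one D]
  exact Finset.sum_filter_add_sum_filter_not _ _ _

theorem setProb_nonneg (D : PMF (Finset U)) (p : Finset U → Prop) [DecidablePred p] :
    0 ≤ setProb D p :=
  Finset.sum_nonneg fun _ _ => ENNReal.toReal_nonneg

theorem sum_mul_eq_zero_of_setProb_eq_zero {D : PMF (Finset U)} {p : Finset U → Prop}
    [DecidablePred p] (h : setProb D p = 0) (g : Finset U → ℝ) :
    ∑ S with p S, (D S).toReal * g S = 0 := by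
  refine Finset.sum_eq_zero fun S hS => ?_
  rw [(Finset.sum_eq_zero_iff_of_nonneg fun _ _ => ENNReal.toReal_nonneg).1 h S hS, zero_mul]

/-- Under weak negative regression, an antitone function of `S \ {i}` is positively correlated
with the event `i ∈ S`. -/
theorem IsWNR.marginals_mul_sum_le {D : PMF (Finset U)} (hD : IsWNR D) (i : U)
    {h : Finset U → ℝ} (hh : Antitone h) :
    marginals D i * ∑ S, (D S).toReal * h (S \ {i}) ≤
      ∑ S with i ∈ S, (D S).toReal * h (S \ {i}) := by
  have hadd := setProb_mem_add_setProb_notMem D i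
  rw [marginals, ← Finset.sum_filter_add_sum_filter_not Finset.univ (fun S => i ∈ S)]
  -- WNR says nothing when `i ∈ S` has probability 0 or 1; there the two sides agree.
  rcases (setProb_nonneg D (fun S => i ∈ S)).eq_or_lt with h0 | h0
  · rw [sum_mul_eq_zero_of_setProb_eq_zero h0.symm (fun S => h (S \ {i})), ← h0]
    simp
  rcases (setProb_nonneg D (fun S => i ∉ S)).eq_or_lt with h1 | h1
  · rw [sum_mul_eq_zero_of_setProb_eq_zero h1.symm (fun S => h (S \ {i}))]
    rw [← h1, add_zero] at hadd
    rw [hadd]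
    simp
  have key := hD i h0 h1 (fun S => -h S) hh.neg
  simp only [condExpectation, mul_neg, Finset.sum_neg_distrib, neg_div, neg_le_neg_iff] at key
  rw [div_le_div_iff₀ h1 h0] at key
  have e : setProb D (fun S => i ∉ S) = 1 - setProb D (fun S => i ∈ S) := by linarith
  rw [e] at key
  nlinarith

end WeakNegativeRegression

/-! ### Weighted matroid rank functions -/

section WeightedRank

variable {U : Type*}

/-- The rank of a finite set in a matroid, as a real number. -/
noncomputable def realRank (M : Matroid U) (S : Finset U) : ℝ :=
  ((M.eRk (S : Set U)).toNat : ℝ)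

theorem coe_toNat_eRk [Fintype U] (M : Matroid U) (X : Set U) : ((M.eRk X).toNat : ℕ∞) = M.eRk X :=
  ENat.natCast_toNat ((M.eRk_le_encard X).trans_lt X.toFinite.encard_lt_top).ne

theorem realRank_mono [Fintype U] (M : Matroid U) : Monotone (realRank M) := by
  intro S T hST
  have h := M.eRk_mono (Finset.coe_subset.2 hST)
  rw [← coe_toNat_eRk M S, ← coe_toNat_eRk M T] at h
  unfold realRank
  exact_mod_cast h

theorem realRank_inter_add_union_le [Fintype U] [DecidableEq U] (M : Matroid U) (S T : Finset U) :
    realRank M (S ∩ T) + realRank M (S ∪ T) ≤ realRank M S + realRank M T := by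
  have h := M.eRk_inter_add_eRk_union_le (S : Set U) (T : Set U)
  rw [← coe_toNat_eRk M, ← coe_toNat_eRk M (S ∪ T), ← coe_toNat_eRk M S,
    ← coe_toNat_eRk M T] at h
  simp only [realRank, Finset.coe_inter, Finset.coe_union]
  exact_mod_cast h

theorem realRank_eq_card {M : Matroid U} {I : Finset U} (hI : M.Indep (I : Set U)) :
    realRank M I = I.card := by
  simp [realRank, hI.eRk_eq_encard]

/-- An independent subset of `S` extends to one whose size is the rank of `S`. -/
theorem exists_indep_card_eq_realRank [Fintype U] {M : Matroid U} {T S : Finset U}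
    (hT : M.Indep (T : Set U)) (hTS : T ⊆ S) :
    ∃ B, T ⊆ B ∧ B ⊆ S ∧ M.Indep (B : Set U) ∧ (B.card : ℝ) = realRank M S := by
  obtain ⟨J, hJ, hTJ⟩ := hT.subset_isBasis'_of_subset (Finset.coe_subset.2 hTS)
  have hc : (J.toFinite.toFinset : Set U) = J := J.toFinite.coe_toFinset
  refine ⟨J.toFinite.toFinset, ?_, ?_, ?_, ?_⟩
  · rw [← Finset.coe_subset, hc]; exact hTJ
  · rw [← Finset.coe_subset, hc]; exact hJ.subset
  · rw [hc]; exact hJ.indep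
  · rw [← realRank_eq_card (by rw [hc]; exact hJ.indep), realRank, realRank, hc, hJ.eRk_eq_eRk]

/-- A monotone set function with diminishing returns. -/
structure IsMonotoneSubmodular [DecidableEq U] (f : Finset U → ℝ) : Prop where
  mono : Monotone f
  marginal_anti : ∀ ⦃A B : Finset U⦄, A ⊆ B → ∀ i, f (insert i B) - f B ≤ f (insert i A) - f A

/-- Submodularity of rank is applied to `insert i S ∩ A` and `T ∩ A`: their union is `insert i T ∩
A` and their intersection contains `S ∩ A`. -/
theorem isMonotoneSubmodular_realRank_inter [Fintype U] [DecidableEq U] (M : Matroid U) (A : Finset U) :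
    IsMonotoneSubmodular (fun S => realRank M (S ∩ A)) where
  mono S T h := realRank_mono M (Finset.inter_subset_inter_right h)
  marginal_anti S T h i := by
    have key := realRank_inter_add_union_le M (insert i S ∩ A) (T ∩ A)
    have h1 : realRank M (S ∩ A) ≤ realRank M (insert i S ∩ A ∩ (T ∩ A)) :=
      realRank_mono M fun x hx => by
        have := @h x
        simp_all
    have h2 : insert i S ∩ A ∪ T ∩ A = insert i T ∩ A := by
      ext x
      have := @h x
      simp only [Finset.mem_union, Finset.mem_inter, Finset.mem_insert]
      tauto
    rw [h2] at key
    linarith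

/-- Nonnegative weights induce a weighted rank function: it is monotone and submodular, it is
attained by an independent subset of each set, and it dominates the weight of independent sets. -/
theorem exists_weightedRank [Fintype U] [DecidableEq U] (M : Matroid U) (w : U → ℝ) (hw : ∀ i, 0 ≤ w i) :
    ∃ f : Finset U → ℝ, IsMonotoneSubmodular f ∧ (∀ S, 0 ≤ f S) ∧
      (∀ I : Finset U, M.Indep (I : Set U) → ∑ i ∈ I, w i ≤ f I) ∧
      ∀ S : Finset U, ∃ T : Finset U, T ⊆ S ∧ M.Indep (T : Set U) ∧ f S ≤ ∑ i ∈ T, w i := by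
  induction hn : (Finset.univ.filter fun i => 0 < w i).card using Nat.strong_induction_on
    generalizing w with
  | _ n ih =>
  set A := Finset.univ.filter fun i => 0 < w i with hA
  rcases A.eq_empty_or_nonempty with hA0 | hA0
  · have hw0 : ∀ i, w i = 0 := fun i => by
      refine le_antisymm (not_lt.1 fun h => ?_) (hw i)
      have : i ∈ A := by simpa [hA] using h
      simp [hA0] at this
    refine ⟨fun _ => 0, ⟨monotone_const, by simp⟩, by simp, by simp [hw0], fun S => ⟨∅, ?_⟩⟩
    simp
  -- Peel off the lowest layer: `w = w' + w k · 1_A`, and `k` leaves the support. Thus `f` becomes a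
  -- positive combination of ranks of level sets.
  obtain ⟨k, hkA, hk⟩ := A.exists_min_image w hA0
  have hk0 : 0 < w k := by simpa [hA] using hkA
  set w' : U → ℝ := fun i => if i ∈ A then w i - w k else 0 with hw'
  have hwA : ∀ i, i ∉ A → w i = 0 := fun i hi =>
    le_antisymm (not_lt.1 fun h => hi (by simpa [hA] using h)) (hw i)
  have hww' : ∀ i, w i = w' i + if i ∈ A then w k else 0 := fun i => by
    by_cases hi : i ∈ A <;> simp [hw', hi, hwA]
  have hw'0 : ∀ i, 0 ≤ w' i := fun i => by
    by_cases hi : i ∈ A <;> simp [hw', hi, hk i]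
  have hlt : (Finset.univ.filter fun i => 0 < w' i).card < n := by
    rw [← hn]
    refine Finset.card_lt_card (Finset.ssubset_iff_of_subset ?_ |>.2 ⟨k, hkA, by simp [hw']⟩)
    intro i hi
    by_contra hc
    simp [hw', hc] at hi
  obtain ⟨f, hf, hf0, hfI, hfT⟩ := ih _ hlt w' hw'0 rfl
  have hr := isMonotoneSubmodular_realRank_inter M A
  have hsum : ∀ T : Finset U, ∑ i ∈ T, w i = ∑ i ∈ T, w' i + w k * (T ∩ A).card := fun T => by
    rw [Finset.sum_congr rfl fun i _ => hww' i, Finset.sum_add_distrib,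
      Finset.sum_ite_mem T A fun _ => w k, Finset.sum_const, nsmul_eq_mul, mul_comm (w k)]
  refine ⟨fun S => f S + w k * realRank M (S ∩ A), ⟨?_, ?_⟩, ?_, ?_, ?_⟩
  · exact hf.mono.add (hr.mono.const_mul hk0.le)
  · intro S T h i
    have h1 := hf.marginal_anti h i
    have h2 := mul_le_mul_of_nonneg_left (hr.marginal_anti h i) hk0.le
    rw [mul_sub, mul_sub] at h2
    linarith
  · exact fun S => add_nonneg (hf0 S) (mul_nonneg hk0.le (Nat.cast_nonneg _))
  · intro I hI
    have hIA : M.Indep ((I ∩ A : Finset U) : Set U) :=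
      hI.subset (Finset.coe_subset.2 Finset.inter_subset_left)
    rw [hsum]
    simp only [realRank_eq_card hIA]
    linarith [hfI I hI]
  · intro S
    obtain ⟨T, hTS, hT, hfT⟩ := hfT S
    have hTA : M.Indep ((T ∩ A : Finset U) : Set U) :=
      hT.subset (Finset.coe_subset.2 Finset.inter_subset_left)
    -- Greedy step: passing to `T ∩ A` loses no `w'`-weight, and extending it to a basis of `S ∩ A`
    -- collects `w k` times the full rank.
    obtain ⟨B, hTB, hBS, hB, hBc⟩ :=
      exists_indep_card_eq_realRank hTA (Finset.inter_subset_inter_right (u := A) hTS)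
    refine ⟨B, hBS.trans Finset.inter_subset_left, hB, ?_⟩
    have h1 : ∑ i ∈ T, w' i = ∑ i ∈ T ∩ A, w' i :=
      (Finset.sum_subset Finset.inter_subset_left fun i hi hi' => by
        have : i ∉ A := fun h => hi' (Finset.mem_inter.2 ⟨hi, h⟩)
        simp [hw', this]).symm
    have h2 := Finset.sum_le_sum_of_subset_of_nonneg hTB fun i _ _ => hw'0 i
    have h3 : B ∩ A = B := Finset.inter_eq_left.2 (hBS.trans Finset.inter_subset_right)
    rw [hsum, h3, hBc]
    linarith

/-- Add the elements of `I` one at a time; each gains at most what it would gain over `T` alone. -/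
theorem IsMonotoneSubmodular.union_sub_le [DecidableEq U] {f : Finset U → ℝ} (hf : IsMonotoneSubmodular f)
    (T I : Finset U) : f (T ∪ I) - f T ≤ ∑ i ∈ I, (f (insert i T) - f T) := by
  induction I using Finset.induction_on with
  | empty => simp
  | insert a I ha ih =>
    rw [Finset.sum_insert ha, Finset.union_insert]
    linarith [hf.marginal_anti (Finset.subset_union_left : T ⊆ T ∪ I) a]

end WeightedRank

/-! ### Correlation gap by random thinning -/

section CorrelationGap

variable {U : Type*} [Fintype U] [DecidableEq U]

/-- The expectation of `g` at the random set obtained from `S ∼ D` by keeping each element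
independently with probability `t`. -/
noncomputable def thinnedExpectation (D : PMF (Finset U)) (t : ℝ) (g : Finset U → ℝ) : ℝ :=
  ∑ S, (D S).toReal * ∑ R, bernoulliWeight t R * g (S ∩ R)

theorem thinnedExpectation_mono (D : PMF (Finset U)) {t : ℝ} (h0 : 0 ≤ t) (h1 : t ≤ 1)
    {g h : Finset U → ℝ} (hgh : ∀ T, g T ≤ h T) :
    thinnedExpectation D t g ≤ thinnedExpectation D t h :=
  Finset.sum_le_sum fun _ _ => mul_le_mul_of_nonneg_left
    (Finset.sum_le_sum fun R _ => mul_le_mul_of_nonneg_left (hgh _)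
      (bernoulliWeight_nonneg h0 h1 R)) ENNReal.toReal_nonneg

theorem thinnedExpectation_const (D : PMF (Finset U)) (t c : ℝ) :
    thinnedExpectation D t (fun _ => c) = c := by
  simp only [thinnedExpectation, ← Finset.sum_mul, sum_bernoulliWeight, one_mul,
    sum_toReal_eq_one]

theorem thinnedExpectation_sub (D : PMF (Finset U)) (t : ℝ) (g h : Finset U → ℝ) :
    thinnedExpectation D t (fun T => g T - h T) =
      thinnedExpectation D t g - thinnedExpectation D t h := by
  simp only [thinnedExpectation, mul_sub, Finset.sum_sub_distrib]

theorem thinnedExpectation_sum (D : PMF (Finset U)) (t : ℝ) (I : Finset U)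
    (g : U → Finset U → ℝ) :
    thinnedExpectation D t (fun T => ∑ i ∈ I, g i T) =
      ∑ i ∈ I, thinnedExpectation D t (g i) := by
  simp only [thinnedExpectation, Finset.mul_sum]
  rw [Finset.sum_comm]
  simp only [Finset.sum_comm (s := I)]
  rw [Finset.sum_comm]

theorem thinnedExpectation_one (D : PMF (Finset U)) (g : Finset U → ℝ) :
    thinnedExpectation D 1 g = ∑ S, (D S).toReal * g S := by
  simp [thinnedExpectation, bernoulliWeight_one]

/-- At a point of the matroid polytope, the weighted marginal gains of a monotone submodular
function dominate the gap to the linear objective. -/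
theorem sum_mul_sub_le_sum_mul_marginal {M : Matroid U} {D : PMF (Finset U)} {f : Finset U → ℝ}
    {w x : U → ℝ} (hf : IsMonotoneSubmodular f)
    (hfw : ∀ I : Finset U, M.Indep (I : Set U) → ∑ i ∈ I, w i ≤ f I)
    (hx : x ∈ matroidPolytope M) {t : ℝ} (h0 : 0 ≤ t) (h1 : t ≤ 1) :
    ∑ i, x i * w i - thinnedExpectation D t f ≤
      ∑ i, x i * thinnedExpectation D t (fun T => f (insert i T) - f T) := by
  set a : U → ℝ := fun i => thinnedExpectation D t (fun T => f (insert i T) - f T)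
  -- The inequality is affine in `x`, so it need only be checked at indicators of independent sets.
  suffices h : matroidPolytope M ⊆
      {y | -thinnedExpectation D t f ≤ ∑ i, y i * (a i - w i)} by
    have := h hx
    simp only [Set.mem_ofPred_eq, mul_sub, Finset.sum_sub_distrib] at this
    linarith
  refine convexHull_min ?_ (convex_halfSpace_ge ⟨fun y z => ?_, fun c y => ?_⟩ _)
  · rintro _ ⟨I, hI, rfl⟩
    have hc : (I.toFinite.toFinset : Set U) = I := I.toFinite.coe_toFinset
    generalize I.toFinite.toFinset = J at hc
    subst hc
    have e : ∀ i, (J : Set U).indicator (1 : U → ℝ) i * (a i - w i) =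
        if i ∈ J then a i - w i else 0 := fun i => by
      by_cases hi : i ∈ J <;> simp [hi]
    simp only [Set.mem_ofPred_eq, e, Finset.sum_ite_mem, Finset.univ_inter,
      Finset.sum_sub_distrib]
    have hsum : f J - thinnedExpectation D t f ≤ ∑ i ∈ J, a i := by
      rw [← thinnedExpectation_sum, ← thinnedExpectation_const D t (f J),
        ← thinnedExpectation_sub]
      refine thinnedExpectation_mono D h0 h1 fun T => ?_
      have h2 := hf.mono (Finset.subset_union_right : J ⊆ T ∪ J)
      linarith [hf.union_sub_le T J]
    linarith [hfw J hI]
  · simp only [Pi.add_apply, add_mul, Finset.sum_add_distrib]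
  · simp only [Pi.smul_apply, smul_eq_mul, mul_assoc, Finset.mul_sum]

/-- Russo's formula for `R ↦ g (S ∩ R)`, averaged over `S`; terms with `i ∉ S` vanish. Writing the
rest through `S \ {i}` at fixed `R` prepares for WNR. -/
theorem hasDerivAt_thinnedExpectation (D : PMF (Finset U)) (g : Finset U → ℝ) (t : ℝ) :
    HasDerivAt (fun t => thinnedExpectation D t g)
      (∑ i, ∑ R, bernoulliWeight t R *
        ∑ S with i ∈ S, (D S).toReal * (g (insert i (S \ {i} ∩ R)) - g (S \ {i} ∩ R))) t := by
  have h := HasDerivAt.fun_sum (fun (S : Finset U) (_ : S ∈ Finset.univ) =>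
    (hasDerivAt_sum_bernoulliWeight_mul (fun R => g (S ∩ R)) t).const_mul (D S).toReal)
  refine h.congr_deriv ?_
  simp only [Finset.mul_sum]
  rw [Finset.sum_comm]
  refine Finset.sum_congr rfl fun i _ => ?_
  rw [Finset.sum_comm]
  refine Finset.sum_congr rfl fun R _ => ?_
  rw [Finset.sum_filter]
  refine Finset.sum_congr rfl fun S _ => ?_
  split_ifs with hi
  · have e1 : S ∩ insert i R = insert i (S \ {i} ∩ R) := by
      ext j
      by_cases hj : j = i <;> simp [hj, hi]
    have e2 : S ∩ R.erase i = S \ {i} ∩ R := by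
      ext j
      by_cases hj : j = i <;> simp [hj]
    rw [e1, e2]
    ring
  · have e : S ∩ insert i R = S ∩ R.erase i := by
      ext j
      by_cases hj : j = i <;> simp [hj, hi]
    rw [e]
    ring

/-- Weak negative regression bounds the derivative of the thinned expectation from below. -/
theorem IsWNR.sum_marginals_mul_le {D : PMF (Finset U)} (hD : IsWNR D) {f : Finset U → ℝ}
    (hf : IsMonotoneSubmodular f) {t : ℝ} (h0 : 0 ≤ t) (h1 : t ≤ 1) :
    ∑ i, marginals D i * thinnedExpectation D t (fun T => f (insert i T) - f T) ≤
      ∑ i, ∑ R, bernoulliWeight t R *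
        ∑ S with i ∈ S, (D S).toReal * (f (insert i (S \ {i} ∩ R)) - f (S \ {i} ∩ R)) := by
  refine Finset.sum_le_sum fun i _ => ?_
  have hanti : ∀ R : Finset U, Antitone fun T => f (insert i (T ∩ R)) - f (T ∩ R) :=
    fun R A B hAB => hf.marginal_anti (Finset.inter_subset_inter_right hAB) i
  have e : thinnedExpectation D t (fun T => f (insert i T) - f T) =
      ∑ R, bernoulliWeight t R * ∑ S, (D S).toReal * (f (insert i (S ∩ R)) - f (S ∩ R)) := by
    simp only [thinnedExpectation, Finset.mul_sum]
    rw [Finset.sum_comm]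
    exact Finset.sum_congr rfl fun _ _ => Finset.sum_congr rfl fun _ _ => by ring
  rw [e, Finset.mul_sum]
  refine Finset.sum_le_sum fun R _ => ?_
  rw [mul_left_comm]
  refine mul_le_mul_of_nonneg_left ?_ (bernoulliWeight_nonneg h0 h1 R)
  -- Deleting `i` from `S` can only raise the gain, and it puts the sum in the form WNR handles.
  refine le_trans (mul_le_mul_of_nonneg_left (Finset.sum_le_sum fun S _ =>
    mul_le_mul_of_nonneg_left (hanti R (Finset.sdiff_subset : S \ {i} ⊆ S))
      ENNReal.toReal_nonneg) (setProb_nonneg D _)) (hD.marginals_mul_sum_le i (hanti R))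

/-- Integrating factor: `e^t (φ t - c)` is nondecreasing on `[0, 1]`, so `e (φ 1 - c) ≥ φ 0 - c ≥
-c`. -/
theorem one_sub_inv_exp_mul_le_of_le_deriv {φ φ' : ℝ → ℝ} {c : ℝ}
    (hφ : ∀ t, HasDerivAt φ (φ' t) t) (h : ∀ t, 0 ≤ t → t ≤ 1 → c - φ t ≤ φ' t)
    (h0 : 0 ≤ φ 0) : (1 - 1 / Real.exp 1) * c ≤ φ 1 := by
  have hd : ∀ t, HasDerivAt (fun t => Real.exp t * (φ t - c))
      (Real.exp t * (φ t - c) + Real.exp t * φ' t) t := fun t =>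
    (Real.hasDerivAt_exp t).mul ((hφ t).sub_const c)
  have hm : MonotoneOn (fun t => Real.exp t * (φ t - c)) (Set.Icc 0 1) := by
    refine monotoneOn_of_deriv_nonneg (convex_Icc 0 1)
      (fun t _ => (hd t).continuousAt.continuousWithinAt)
      (fun t _ => (hd t).differentiableAt.differentiableWithinAt) fun t ht => ?_
    rw [interior_Icc] at ht
    rw [(hd t).deriv, ← mul_add]
    exact mul_nonneg (Real.exp_pos t).le (by linarith [h t ht.1.le ht.2.le])
  have key := hm (Set.left_mem_Icc.2 zero_le_one) (Set.right_mem_Icc.2 zero_le_one) zero_le_one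
  simp only [Real.exp_zero, one_mul] at key
  have he := Real.exp_pos 1
  rw [← mul_le_mul_iff_right₀ he, ← mul_assoc, mul_sub, mul_one_div_cancel he.ne']
  linarith

/-- The correlation gap of distributions with weak negative regression. -/
theorem IsWNR.one_sub_inv_exp_mul_le {M : Matroid U} {D : PMF (Finset U)} (hD : IsWNR D)
    (hx : marginals D ∈ matroidPolytope M) {f : Finset U → ℝ} {w : U → ℝ}
    (hf : IsMonotoneSubmodular f) (hf0 : ∀ S, 0 ≤ f S)
    (hfw : ∀ I : Finset U, M.Indep (I : Set U) → ∑ i ∈ I, w i ≤ f I) :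
    (1 - 1 / Real.exp 1) * ∑ i, marginals D i * w i ≤ ∑ S, (D S).toReal * f S := by
  rw [← thinnedExpectation_one]
  refine one_sub_inv_exp_mul_le_of_le_deriv (hasDerivAt_thinnedExpectation D f)
    (fun t h0 h1 => (sum_mul_sub_le_sum_mul_marginal hf hfw hx h0 h1).trans
      (hD.sum_marginals_mul_le hf h0 h1)) ?_
  exact (thinnedExpectation_const D 0 0).ge.trans <|
    thinnedExpectation_mono D le_rfl zero_le_one hf0

end CorrelationGap

/-! ### From deterministic schemes per objective to one randomized scheme -/

section Duality

variable {U : Type*} [Fintype U]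

/-- The randomized maps, given by their transition matrices, that send each set to independent
subsets of it. -/
def schemeMatrices (M : Matroid U) : Set (Finset U → Finset U → ℝ) :=
  Set.univ.pi fun S =>
    stdSimplex ℝ (Finset U) ∩ {q | ∀ T, ¬(T ⊆ S ∧ M.Indep (T : Set U)) → q T = 0}

theorem isCompact_schemeMatrices (M : Matroid U) : IsCompact (schemeMatrices M) := by
  refine isCompact_univ_pi fun S => (isCompact_stdSimplex ℝ _).inter_right ?_
  simp only [Set.ofPred_forall]
  exact isClosed_iInter fun T => isClosed_iInter fun _ =>
    isClosed_eq (continuous_apply T) continuous_const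

theorem convex_schemeMatrices (M : Matroid U) : Convex ℝ (schemeMatrices M) := by
  refine convex_pi fun S _ => (convex_stdSimplex ℝ _).inter ?_
  intro p hp q hq a b _ _ _ T hT
  simp [hp T hT, hq T hT]

variable [DecidableEq U]

/-- The vector of selection probabilities of a transition matrix. -/
noncomputable def selectionProb (D : PMF (Finset U)) :
    (Finset U → Finset U → ℝ) →ₗ[ℝ] (U → ℝ) where
  toFun p i := ∑ S, (D S).toReal * ∑ T with i ∈ T, p S T
  map_add' p q := by
    ext i
    simp [Finset.sum_add_distrib, mul_add]
  map_smul' c p := by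
    ext i
    simp only [Pi.smul_apply, smul_eq_mul, ← Finset.mul_sum, RingHom.id_apply, mul_left_comm]

/-- A transition matrix of independent subsets is realized by a contention resolution scheme. -/
theorem exists_scheme_of_mem_schemeMatrices {M : Matroid U} (D : PMF (Finset U))
    {p : Finset U → Finset U → ℝ} (hp : p ∈ schemeMatrices M) :
    ∃ π : Finset U → PMF (Finset U), IsContentionResolutionScheme M π ∧
      ∀ i, setProb (D.bind π) (fun T => i ∈ T) = selectionProb D p i := by
  have hp' := fun S => hp S (Set.mem_univ S)
  have hsum : ∀ S, ∑ T, ENNReal.ofReal (p S T) = 1 := fun S => by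
    rw [← ENNReal.ofReal_sum_of_nonneg fun T _ => (hp' S).1.1 T, (hp' S).1.2, ENNReal.ofReal_one]
  refine ⟨fun S => PMF.ofFintype (fun T => ENNReal.ofReal (p S T)) (hsum S), ?_, fun i => ?_⟩
  · intro S T hT
    by_contra hc
    rw [PMF.mem_support_iff, PMF.ofFintype_apply, (hp' S).2 T hc] at hT
    simp at hT
  · simp only [setProb, selectionProb, LinearMap.coe_mk, AddHom.coe_mk, Finset.mul_sum]
    rw [Finset.sum_comm]
    refine Finset.sum_congr rfl fun T _ => ?_
    rw [PMF.bind_apply, tsum_fintype, ENNReal.toReal_sum fun S _ =>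
      ENNReal.mul_ne_top (D.apply_ne_top S) (PMF.apply_ne_top _ T)]
    refine Finset.sum_congr rfl fun S _ => ?_
    rw [ENNReal.toReal_mul, PMF.ofFintype_apply, ENNReal.toReal_ofReal ((hp' S).1.1 T)]

/-- A deterministic choice of independent subsets, as a transition matrix. -/
theorem indicator_mem_schemeMatrices {M : Matroid U} {τ : Finset U → Finset U}
    (hτ : ∀ S, τ S ⊆ S ∧ M.Indep (τ S : Set U)) :
    (fun S T => if T = τ S then (1 : ℝ) else 0) ∈ schemeMatrices M := by
  refine fun S _ => ⟨⟨fun T => ?_, by simp⟩, fun T hT => if_neg ?_⟩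
  · dsimp only
    split_ifs <;> norm_num
  · rintro rfl
    exact hT (hτ S)

theorem sum_selectionProb_indicator_mul (D : PMF (Finset U)) (τ : Finset U → Finset U)
    (w : U → ℝ) :
    ∑ i, selectionProb D (fun S T => if T = τ S then (1 : ℝ) else 0) i * w i =
      ∑ S, (D S).toReal * ∑ i ∈ τ S, w i := by
  have e : ∀ i, selectionProb D (fun S T => if T = τ S then (1 : ℝ) else 0) i =
      ∑ S, (D S).toReal * if i ∈ τ S then 1 else 0 := fun i => by
    simp [selectionProb, Finset.sum_ite_eq']
  simp only [e, Finset.sum_mul]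
  rw [Finset.sum_comm]
  refine Finset.sum_congr rfl fun S _ => ?_
  simp [← Finset.mul_sum]

/-- Separation: a vector is dominated by the selection probabilities of some scheme as soon as
every nonnegative objective admits a deterministic scheme that does at least as well. -/
theorem exists_le_selectionProb (M : Matroid U) (D : PMF (Finset U)) (y : U → ℝ)
    (h : ∀ w : U → ℝ, (∀ i, 0 ≤ w i) → ∃ τ : Finset U → Finset U,
      (∀ S, τ S ⊆ S ∧ M.Indep (τ S : Set U)) ∧
        ∑ i, y i * w i ≤ ∑ S, (D S).toReal * ∑ i ∈ τ S, w i) :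
    ∃ p ∈ schemeMatrices M, y ≤ selectionProb D p := by
  by_contra! hc
  have hdisj : Disjoint (selectionProb D '' schemeMatrices M) (Set.Ici y) := by
    rw [Set.disjoint_left]
    rintro _ ⟨p, hp, rfl⟩ hy
    exact hc p hp hy
  obtain ⟨F, u, v, hu, huv, hv⟩ := geometric_hahn_banach_compact_closed
    ((convex_schemeMatrices M).linear_image _)
    ((isCompact_schemeMatrices M).image (LinearMap.continuous_of_finiteDimensional _))
    (convex_Ici y) isClosed_Ici hdisj
  set w : U → ℝ := fun i => F (Pi.single i 1) with hw
  have hF : ∀ z : U → ℝ, F z = ∑ i, z i * w i := fun z => by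
    conv_lhs => rw [← Finset.univ_sum_single z, map_sum]
    refine Finset.sum_congr rfl fun i _ => ?_
    rw [hw, ← smul_eq_mul, ← map_smul, ← Pi.single_smul, smul_eq_mul, mul_one]
  have hw0 : ∀ i, 0 ≤ w i := by
    intro i
    by_contra! hi
    -- If `w i < 0`, moving up from `y` along `i` by this step stays in the orthant but brings `F`
    -- down to exactly `v`, against the strict separation.
    have hs : 0 ≤ (v - F y) / w i :=
      div_nonneg_of_nonpos (by linarith [hv y Set.self_mem_Ici]) hi.le
    have := hv (y + ((v - F y) / w i) • Pi.single i 1) (by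
      rw [Set.mem_Ici]
      exact le_add_of_nonneg_right (smul_nonneg hs (Pi.single_nonneg.2 zero_le_one)))
    rw [map_add, map_smul, smul_eq_mul, div_mul_cancel₀ _ hi.ne] at this
    linarith
  obtain ⟨τ, hτ, hle⟩ := h w hw0
  have h1 := hu _ ⟨_, indicator_mem_schemeMatrices hτ, rfl⟩
  have h2 := hv y Set.self_mem_Ici
  rw [hF, sum_selectionProb_indicator_mul] at h1
  rw [hF] at h2
  linarith

end Duality

theorem theorem1p9 {U : Type*} [Fintype U] [DecidableEq U] (M : Matroid U)
    (D : PMF (Finset U)) (hD : IsWNR D) (hx : marginals D ∈ matroidPolytope M) :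
    ∃ π : Finset U → PMF (Finset U),
      IsContentionResolutionScheme M π ∧ IsSelectable (1 - 1 / Real.exp 1) D π := by
  obtain ⟨p, hp, hle⟩ := exists_le_selectionProb M D
    (fun i => (1 - 1 / Real.exp 1) * marginals D i) fun w hw => by
      obtain ⟨f, hf, hf0, hfI, hfT⟩ := exists_weightedRank M w hw
      -- For the objective `w`, `τ S` is an independent subset of `S` of weight at least `f S`, so
      -- the correlation gap of `f` passes to `τ`.
      choose τ hτS hτ hfτ using hfT
      refine ⟨τ, fun S => ⟨hτS S, hτ S⟩, ?_⟩
      simp only [mul_assoc, ← Finset.mul_sum]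
      exact (hD.one_sub_inv_exp_mul_le hx hf hf0 hfI).trans (Finset.sum_le_sum fun S _ =>
        mul_le_mul_of_nonneg_left (hfτ S) ENNReal.toReal_nonneg)
  obtain ⟨π, hπ, hsel⟩ := exists_scheme_of_mem_schemeMatrices D hp
  exact ⟨π, hπ, fun i => (hle i).trans_eq (hsel i).symm⟩
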